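/- Boolean PCF with algebraic effects ($\mathrm{BPCF}_{\mathrm{AE}}$) is the following call-by-value simply typed language. Types are $\tau ::= b \mid \tau_1\to\tau_2$ with base types $b ::= \mathsf{unit}\mid\mathsf{bool}$. Fix a finite set of algebraic effects $\alpha_1,\dots,\alpha_\ell$ and a type assignment $\mathcal A(\alpha_i)=b_i\to b_i'$ with $b_i,b_i'$ base types. Expressions are $$M ::= \mathtt{fail}\mid V\mid x\mid M_1M_2\mid Y(\lambda f.\lambda x.M)\mid \mathtt{if}\ M_0\ \mathtt{then}\ M_1\ \mathtt{else}\ M_2\mid \alpha(W_1;W_2)\mid \mathtt{handle}\ M\ \mathtt{with}\ H,$$ where $V ::= ()\mid\mathtt{true}\mid\mathtt{false}\mid\lambda x.M$ ranges over values, $W_1,W_2$ are values or variables, and $H=\{\mathtt{return}\,x\mapsto M_0,\ \alpha_1(x;c)\mapsto M_1,\dots,\alpha_\ell(x;c)\mapsto M_\ell\}$ has one clause for each effect. *Typing.* The rules are the usual ones of simply typed $\lambda$-calculus with recursion and Booleans; $\mathtt{fail}$ has every type; $\Gamma\vdash\alpha_i(W_1;W_2):\tau$ if $\Gamma\vdash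 W_1:b_i$ and $\Gamma\vdash W_2:b_i'\to\tau$; and $\Gamma\vdash\mathtt{handle}\ M\ \mathtt{with}\ H:\tau_2$ if, for some $\tau_1$, $\Gamma\vdash M:\tau_1$, $\Gamma,x{:}\tau_1\vdash M_0:\tau_2$, and $\Gamma,x{:}b_i,c{:}b_i'\to\rho\vdash M_i:\tau_2$ for every $i$, where $\rho=\tau_2$ for deep handlers and $\rho=\tau_1$ for shallow handlers. *Reduction.* Evaluation contexts are $E ::= [\,]\mid E\,M\mid V\,E\mid \mathtt{if}\ E\ \mathtt{then}\ M_1\ \mathtt{else}\ M_2\mid\alpha(E;V)\mid\mathtt{handle}\ E\ \mathtt{with}\ H$, and $F$ ranges over those evaluation contexts whose hole is not inside a $\mathtt{handle}$ of $F$. The steps are $E[\mathtt{fail}]\to\mathtt{fail}$, the usual steps for $\beta_V$ and conditionals, $E[Y(\lambda f.\lambda x.M)]\to E[\lambda x.[Y(\lambda f.\lambda x.M)/f]M]$, $E[\mathtt{handle}\ V\ \mathtt{with}\ H]\to E[[V/x]M_0]$, and $$E[\mathtt{handle}\ F[\alpha_i(V_1;V_2)]\ \mathtt{with}\ H]\to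 E[[V_1/x,K/c]M_i],$$ where $K=\lambda y.\,\mathtt{handle}\ F[V_2\,y]\ \mathtt{with}\ H$ in the deep handler semantics and $K=\lambda y.\,F[V_2\,y]$ in the shallow handler semantics ($y$ fresh). The *reachability problem* is to decide, given a closed expression $M$ with $\vdash M:b$ for some base type $b$, whether $M\to^*\mathtt{fail}$. **Theorem.** The reachability problem for $\mathrm{BPCF}_{\mathrm{AE}}$ is undecidable both for shallow and for deep handlers. More precisely: 1. for every signature $(\alpha_1,\dots,\alpha_\ell;\mathcal A)$ with at least two distinct effects of type $\mathsf{unit}\to\mathsf{unit}$, the reachability problem under shallow handlers is undecidable; 2. for every signature $(\alpha_1,\dots,\alpha_\ell;\mathcal A)$ with at least four distinct effects of type $\mathsf{unit}\to\mathsf{unit}$, the reachability problem under deep handlers is undecidable. -/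

import Mathlib

/-! Boolean PCF with algebraic effects on base types: syntax (with de Bruijn indices), Curry-style
typing, call-by-value semantics, and the reachability problem. -/

namespace BPCFAE

/-- Base types. -/
inductive BaseTy : Type
  | unit
  | bool

/-- Simple types. -/
inductive Ty : Type
  | base (b : BaseTy)
  | arrow (σ τ : Ty)

/-- The two semantics of effect handlers. -/
inductive Mode : Type
  | shallow
  | deep

/-- A signature with `n` algebraic effects: `A α = (b₁, b₂)` means that the effect `α` is an
operation from `b₁` to `b₂`. -/
abbrev Sig (n : ℕ) : Type := Fin n → BaseTy × BaseTy

/-- Expressions over the effect names `Fin n`. Variables are de Bruijn indices.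
* `lam M`: `M` binds the parameter as index `0`.
* `fix M` is the recursive function `Y (λ f. λ x. M)`: `x` is index `0` and `f` is index `1`.
* `op α V₁ V₂` is the invocation `α(V₁; V₂)` with operand `V₁` and continuation `V₂`.
* `handle M M₀ H` is `handle M with {return x ↦ M₀, α₁(x; c) ↦ H α₁, …, αₙ(x; c) ↦ H αₙ}`;
  in `M₀`, `x` is index `0`; in `H α`, `c` is index `0` and `x` is index `1`. -/
inductive Term (n : ℕ) : Type
  | fail
  | var (i : ℕ)
  | unit
  | tt
  | ff
  | lam (M : Term n)
  | app (M N : Term n)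
  | fix (M : Term n)
  | ite (M₀ M₁ M₂ : Term n)
  | op (α : Fin n) (V₁ V₂ : Term n)
  | handle (M M₀ : Term n) (H : Fin n → Term n)

namespace Term

variable {n : ℕ}

/-- Values. -/
inductive IsValue : Term n → Prop
  | unit : IsValue unit
  | tt : IsValue tt
  | ff : IsValue ff
  | lam (M : Term n) : IsValue (lam M)

/-- The expressions that may be written as the arguments of an effect invocation:
values and variables. -/
inductive IsArg : Term n → Prop
  | val {V : Term n} : IsValue V → IsArg V
  | var (i : ℕ) : IsArg (var i)

/-- Lifting of a renaming under one binder. -/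
def liftRen (ξ : ℕ → ℕ) : ℕ → ℕ
  | 0 => 0
  | i + 1 => ξ i + 1

/-- Renaming of free variables. -/
def rename (ξ : ℕ → ℕ) : Term n → Term n
  | fail => fail
  | var i => var (ξ i)
  | unit => unit
  | tt => tt
  | ff => ff
  | lam M => lam (rename (liftRen ξ) M)
  | app M N => app (rename ξ M) (rename ξ N)
  | fix M => fix (rename (liftRen (liftRen ξ)) M)
  | ite M₀ M₁ M₂ => ite (rename ξ M₀) (rename ξ M₁) (rename ξ M₂)
  | op α V₁ V₂ => op α (rename ξ V₁) (rename ξ V₂)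
  | handle M M₀ H =>
      handle (rename ξ M) (rename (liftRen ξ) M₀) (fun α => rename (liftRen (liftRen ξ)) (H α))

/-- Lifting of a substitution under one binder. -/
def liftSub (s : ℕ → Term n) : ℕ → Term n
  | 0 => var 0
  | i + 1 => rename Nat.succ (s i)

/-- Simultaneous capture-avoiding substitution. -/
def subst (s : ℕ → Term n) : Term n → Term n
  | fail => fail
  | var i => s i
  | unit => unit
  | tt => tt
  | ff => ff
  | lam M => lam (subst (liftSub s) M)
  | app M N => app (subst s M) (subst s N)
  | fix M => fix (subst (liftSub (liftSub s)) M)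
  | ite M₀ M₁ M₂ => ite (subst s M₀) (subst s M₁) (subst s M₂)
  | op α V₁ V₂ => op α (subst s V₁) (subst s V₂)
  | handle M M₀ H =>
      handle (subst s M) (subst (liftSub s) M₀) (fun α => subst (liftSub (liftSub s)) (H α))

/-- The substitution replacing index `0` by `N` and lowering all other indices by one. -/
def single (N : Term n) : ℕ → Term n
  | 0 => N
  | i + 1 => var i

/-- The substitution replacing index `0` by `K`, index `1` by `N`, and lowering all other indices
by two. -/
def double (K N : Term n) : ℕ → Term n
  | 0 => K
  | 1 => N
  | i + 2 => var i

/-- A Gödel numbering of expressions, built from the pairing function on `ℕ`. -/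
def code : Term n → ℕ
  | fail => Nat.pair 0 0
  | var i => Nat.pair 1 i
  | unit => Nat.pair 2 0
  | tt => Nat.pair 3 0
  | ff => Nat.pair 4 0
  | lam M => Nat.pair 5 (code M)
  | app M N => Nat.pair 6 (Nat.pair (code M) (code N))
  | fix M => Nat.pair 7 (code M)
  | ite M₀ M₁ M₂ => Nat.pair 8 (Nat.pair (code M₀) (Nat.pair (code M₁) (code M₂)))
  | op α V₁ V₂ => Nat.pair 9 (Nat.pair α (Nat.pair (code V₁) (code V₂)))
  | handle M M₀ H =>
      Nat.pair 10 (Nat.pair (code M) (Nat.pair (code M₀)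
        (Encodable.encode (List.ofFn fun α => code (H α)))))

/-- Distinct expressions have distinct codes. -/
theorem code_injective : Function.Injective (code : Term n → ℕ) := by
  intro M
  induction M with
  | handle M M₀ H ihM ih₀ ihH =>
    intro N h
    cases N <;> simp only [code, Nat.pair_eq_pair, Encodable.encode_inj, List.ofFn_inj] at h <;>
      try omega
    obtain ⟨-, h₁, h₂, h₃⟩ := h
    rw [ihM h₁, ih₀ h₂]
    congr
    funext α
    exact ihH α (congrFun h₃ α)
  | _ =>
    intro N h
    cases N <;> simp only [code, Nat.pair_eq_pair, Fin.val_inj] at h <;> grind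

end Term

open Term

/-- The typing judgment `Γ ⊢ M : σ`. Index `i` of `M` has the type at position `i` of `Γ`.
The two modes differ only in the type of the continuation in a handler. -/
inductive HasType {n : ℕ} (m : Mode) (A : Sig n) : List Ty → Term n → Ty → Prop
  | fail {Γ : List Ty} {σ : Ty} : HasType m A Γ fail σ
  | var {Γ : List Ty} {i : ℕ} {σ : Ty} : Γ[i]? = some σ → HasType m A Γ (var i) σ
  | unit {Γ : List Ty} : HasType m A Γ unit (.base .unit)
  | tt {Γ : List Ty} : HasType m A Γ tt (.base .bool)
  | ff {Γ : List Ty} : HasType m A Γ ff (.base .bool)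
  | lam {Γ : List Ty} {M : Term n} {σ τ : Ty} :
      HasType m A (σ :: Γ) M τ → HasType m A Γ (lam M) (.arrow σ τ)
  | app {Γ : List Ty} {M N : Term n} {σ τ : Ty} :
      HasType m A Γ M (.arrow σ τ) → HasType m A Γ N σ → HasType m A Γ (app M N) τ
  | fix {Γ : List Ty} {M : Term n} {σ τ : Ty} :
      HasType m A (σ :: .arrow σ τ :: Γ) M τ → HasType m A Γ (fix M) (.arrow σ τ)
  | ite {Γ : List Ty} {M₀ M₁ M₂ : Term n} {σ : Ty} :
      HasType m A Γ M₀ (.base .bool) → HasType m A Γ M₁ σ → HasType m A Γ M₂ σ →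
      HasType m A Γ (ite M₀ M₁ M₂) σ
  | op {Γ : List Ty} {α : Fin n} {V₁ V₂ : Term n} {σ : Ty} :
      IsArg V₁ → IsArg V₂ →
      HasType m A Γ V₁ (.base (A α).1) → HasType m A Γ V₂ (.arrow (.base (A α).2) σ) →
      HasType m A Γ (op α V₁ V₂) σ
  | handle {Γ : List Ty} {M M₀ : Term n} {H : Fin n → Term n} {σ₁ σ₂ : Ty} :
      HasType m A (σ₁ :: Γ) M₀ σ₂ →
      (∀ α, HasType m A
        (.arrow (.base (A α).2) (match m with | .deep => σ₂ | .shallow => σ₁) ::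
          .base (A α).1 :: Γ) (H α) σ₂) →
      HasType m A Γ M σ₁ →
      HasType m A Γ (handle M M₀ H) σ₂

/-- One-hole contexts whose hole is not under a binder. -/
inductive Ctx (n : ℕ) : Type
  | hole
  | appL (E : Ctx n) (M : Term n)
  | appR (V : Term n) (E : Ctx n)
  | ite (E : Ctx n) (M₁ M₂ : Term n)
  | op (α : Fin n) (E : Ctx n) (V : Term n)
  | handle (E : Ctx n) (M₀ : Term n) (H : Fin n → Term n)

namespace Ctx

variable {n : ℕ}

/-- `E.plug M` is `E[M]`. -/
def plug : Ctx n → Term n → Term n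
  | hole, M => M
  | appL E N, M => .app (plug E M) N
  | appR V E, M => .app V (plug E M)
  | ite E M₁ M₂, M => .ite (plug E M) M₁ M₂
  | op α E V, M => .op α (plug E M) V
  | handle E M₀ H, M => .handle (plug E M) M₀ H

/-- Renaming of the free variables of a context. -/
def rename (ξ : ℕ → ℕ) : Ctx n → Ctx n
  | hole => hole
  | appL E M => appL (rename ξ E) (M.rename ξ)
  | appR V E => appR (V.rename ξ) (rename ξ E)
  | ite E M₁ M₂ => ite (rename ξ E) (M₁.rename ξ) (M₂.rename ξ)
  | op α E V => op α (rename ξ E) (V.rename ξ)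
  | handle E M₀ H =>
      handle (rename ξ E) (M₀.rename (liftRen ξ)) (fun α => (H α).rename (liftRen (liftRen ξ)))

/-- Evaluation contexts `E`. -/
inductive IsEval : Ctx n → Prop
  | hole : IsEval hole
  | appL {E : Ctx n} {M : Term n} : IsEval E → IsEval (appL E M)
  | appR {V : Term n} {E : Ctx n} : IsValue V → IsEval E → IsEval (appR V E)
  | ite {E : Ctx n} {M₁ M₂ : Term n} : IsEval E → IsEval (ite E M₁ M₂)
  | op {α : Fin n} {E : Ctx n} {V : Term n} : IsEval E → IsValue V → IsEval (op α E V)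
  | handle {E : Ctx n} {M₀ : Term n} {H : Fin n → Term n} : IsEval E → IsEval (handle E M₀ H)

/-- The hole of the context is not enclosed by a handler of the context. -/
def NoHandler : Ctx n → Prop
  | hole => True
  | appL E _ => NoHandler E
  | appR _ E => NoHandler E
  | ite E _ _ => NoHandler E
  | op _ E _ => NoHandler E
  | handle _ _ _ => False

end Ctx

/-- The continuation passed to the handler `{M₀, H}` of `F[α(V₁; V₂)]`: `λ y. F[V₂ y]` for shallow
handlers, and `λ y. handle F[V₂ y] with {M₀, H}` for deep handlers. The free variables of `F`, `V₂`,
`M₀` and `H` are renamed because they are moved under the binder of `y`. -/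
def resumption {n : ℕ} (m : Mode) (F : Ctx n) (V₂ M₀ : Term n) (H : Fin n → Term n) : Term n :=
  let body : Term n := (F.rename Nat.succ).plug (app (V₂.rename Nat.succ) (var 0))
  match m with
  | .shallow => lam body
  | .deep =>
      lam (handle body (M₀.rename (liftRen Nat.succ))
        (fun α => (H α).rename (liftRen (liftRen Nat.succ))))

/-- Contraction of redexes. -/
inductive Contract {n : ℕ} (m : Mode) : Term n → Term n → Prop
  | beta {M V : Term n} : IsValue V → Contract m (app (lam M) V) (M.subst (single V))
  | iteTrue {M₁ M₂ : Term n} : Contract m (ite tt M₁ M₂) M₁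
  | iteFalse {M₁ M₂ : Term n} : Contract m (ite ff M₁ M₂) M₂
  | fix {M : Term n} : Contract m (fix M) (lam (M.subst (liftSub (single (fix M)))))
  | ret {V M₀ : Term n} {H : Fin n → Term n} :
      IsValue V → Contract m (handle V M₀ H) (M₀.subst (single V))
  | eff {F : Ctx n} {α : Fin n} {V₁ V₂ M₀ : Term n} {H : Fin n → Term n} :
      F.IsEval → F.NoHandler → IsValue V₁ → IsValue V₂ →
      Contract m (handle (F.plug (op α V₁ V₂)) M₀ H)
        ((H α).subst (double (resumption m F V₂ M₀ H) V₁))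

/-- The one-step reduction relation. -/
inductive Red {n : ℕ} (m : Mode) : Term n → Term n → Prop
  | step {E : Ctx n} {M N : Term n} :
      E.IsEval → Contract m M N → Red m (E.plug M) (E.plug N)
  | fail {E : Ctx n} : E.IsEval → Red m (E.plug fail) fail

/-- `M` reduces to `fail` in finitely many steps. -/
def Reaches {n : ℕ} (m : Mode) (M : Term n) : Prop :=
  Relation.ReflTransGen (Red m) M fail

/-- The reachability problem is decidable: some algorithm, given the code of a closed expression `M`
of base type, terminates and answers whether `M` reaches `fail`. Nothing is required of the
algorithm on other inputs. -/
def ReachabilityDecidable {n : ℕ} (m : Mode) (A : Sig n) : Prop :=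
  ∃ f : ℕ →. Bool, Partrec f ∧
    ∀ M : Term n, (∃ b : BaseTy, HasType m A [] M (.base b)) →
      ∃ r ∈ f M.code, (r = true ↔ Reaches m M)

end BPCFAE

namespace BPCFAE

open Term

/-! ### Renaming and substitution -/

namespace Term

variable {n : ℕ}

/-! A thunk of type `unit → unit` can carry an unbounded word: with two effects read as the letters
`true` and `false`, it stands for the sequence of effects that it performs when run. Pushing a
letter prefixes one effect, and a handler reads the first letter by discarding the continuation. A
shallow handler removes the first letter by returning the continuation. A deep handler reinstalls
itself in the continuation, so it is made to compute a function of a Boolean that is applied outside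
the handler: `ff` performs the effect again and `tt` skips it. The whole is applied to `tt`, and
every resumption to `ff` (`Emits.deep_fold`, `Represents.tl`).

Words encode lists of naturals in unary, and with recursion these operations interpret every
`Turing.ToPartrec.Code` (`implements_compile`). Applying `λ x. fail` to the result of the compiled
program makes `fail` reachable exactly when the program halts (`reaches_iff_dom`); a code with
undecidable domain finishes the argument.

That divergence excludes `fail` rests on determinism (`Red.deterministic`): a reduction to `fail`
has to follow the simulated run, and each loop iteration uses up at least one of its finitely many
steps. -/

theorem liftSub_comp_liftRen (s : ℕ → Term n) (ξ : ℕ → ℕ) :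
    liftSub s ∘ liftRen ξ = liftSub (s ∘ ξ) := by
  funext i; cases i <;> rfl

theorem subst_rename (M : Term n) (ξ : ℕ → ℕ) (s : ℕ → Term n) :
    (M.rename ξ).subst s = M.subst (s ∘ ξ) := by
  induction M generalizing ξ s <;> simp_all [rename, subst, liftSub_comp_liftRen]

theorem liftSub_var : liftSub var = (var : ℕ → Term n) := by
  funext i; cases i <;> rfl

@[simp]
theorem subst_var (M : Term n) : M.subst var = M := by
  induction M <;> simp_all [subst, liftSub_var]

theorem liftSub_var_comp (ξ : ℕ → ℕ) :
    liftSub (var ∘ ξ) = (var ∘ liftRen ξ : ℕ → Term n) := by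
  funext i; cases i <;> rfl

theorem rename_eq_subst (M : Term n) (ξ : ℕ → ℕ) : M.rename ξ = M.subst (var ∘ ξ) := by
  induction M generalizing ξ <;> simp_all [rename, subst, liftSub_var_comp]

@[simp]
theorem rename_succ_subst_single (M N : Term n) : (M.rename Nat.succ).subst (single N) = M := by
  rw [subst_rename]; exact subst_var M

@[simp]
theorem rename_succ_succ_subst_liftSub_single (M N : Term n) :
    ((M.rename Nat.succ).rename Nat.succ).subst (liftSub (single N)) = M.rename Nat.succ := by
  rw [subst_rename, subst_rename, rename_eq_subst]
  rfl

@[simp] theorem liftSub_zero (s : ℕ → Term n) : liftSub s 0 = var 0 := rfl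
@[simp] theorem liftSub_one (s : ℕ → Term n) : liftSub s 1 = (s 0).rename Nat.succ := rfl
@[simp] theorem liftSub_two (s : ℕ → Term n) : liftSub s 2 = (s 1).rename Nat.succ := rfl
@[simp] theorem single_zero (N : Term n) : single N 0 = N := rfl
@[simp] theorem double_zero (K N : Term n) : double K N 0 = K := rfl

end Term

/-! ### Typing -/

section Typing

variable {n : ℕ} {m : Mode} {A : Sig n}

/-- New types at the far end of the context leave all de Bruijn indices in place, so no renaming of
the term is needed. -/
theorem HasType.append {Γ : List Ty} {M : Term n} {σ : Ty} (h : HasType m A Γ M σ)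
    (Δ : List Ty) : HasType m A (Γ ++ Δ) M σ := by
  induction h with
  | fail => exact .fail
  | var h =>
    refine .var ?_
    rw [List.getElem?_append_left (List.getElem?_eq_some_iff.1 h).1, h]
  | unit => exact .unit
  | tt => exact .tt
  | ff => exact .ff
  | lam _ ih => exact .lam ih
  | app _ _ ih₁ ih₂ => exact .app ih₁ ih₂
  | fix _ ih => exact .fix ih
  | ite _ _ _ ih₀ ih₁ ih₂ => exact .ite ih₀ ih₁ ih₂
  | op h₁ h₂ _ _ ih₁ ih₂ => exact .op h₁ h₂ ih₁ ih₂
  | handle _ _ _ ih₀ ihH ih => exact .handle ih₀ ihH ih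

theorem HasType.weaken {M : Term n} {σ : Ty} (h : HasType m A [] M σ) (Γ : List Ty) :
    HasType m A Γ M σ := h.append Γ

theorem liftSub_eq_var {k : ℕ} {s : ℕ → Term n} (hs : ∀ i < k, s i = .var i) :
    ∀ i < k + 1, liftSub s i = .var i := by
  intro i hi
  cases i with
  | zero => rfl
  | succ i => simp [liftSub, hs i (by omega), rename]

/-- A typing derivation doubles as a scoping certificate: all free indices lie below the length of
the context. Closedness of the compiled terms is obtained this way. -/
theorem HasType.subst_eq {Γ : List Ty} {M : Term n} {σ : Ty} (h : HasType m A Γ M σ)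
    {s : ℕ → Term n} (hs : ∀ i < Γ.length, s i = .var i) : M.subst s = M := by
  induction h generalizing s with
  | var h => exact hs _ (List.getElem?_eq_some_iff.1 h).1
  | fail | unit | tt | ff => rfl
  | lam _ ih => simp [subst, ih (liftSub_eq_var hs)]
  | app _ _ ih₁ ih₂ => simp [subst, ih₁ hs, ih₂ hs]
  | fix _ ih => simp [subst, ih (liftSub_eq_var (liftSub_eq_var hs))]
  | ite _ _ _ ih₀ ih₁ ih₂ => simp [subst, ih₀ hs, ih₁ hs, ih₂ hs]
  | op _ _ _ _ ih₁ ih₂ => simp [subst, ih₁ hs, ih₂ hs]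
  | handle _ _ _ ih₀ ihH ih =>
    simp [subst, ih hs, ih₀ (liftSub_eq_var hs),
      fun α => ihH α (liftSub_eq_var (liftSub_eq_var hs))]

theorem HasType.closed_subst {M : Term n} {σ : Ty} (h : HasType m A [] M σ) (s : ℕ → Term n) :
    M.subst s = M := h.subst_eq (by simp)

theorem HasType.closed_rename {M : Term n} {σ : Ty} (h : HasType m A [] M σ) (ξ : ℕ → ℕ) :
    M.rename ξ = M := by rw [rename_eq_subst, h.closed_subst]

end Typing

/-! ### Composition of contexts -/

namespace Ctx

variable {n : ℕ}

/-- `E.comp E'` is `E[E']`. -/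
def comp : Ctx n → Ctx n → Ctx n
  | hole, E' => E'
  | appL E N, E' => .appL (comp E E') N
  | appR V E, E' => .appR V (comp E E')
  | ite E M₁ M₂, E' => .ite (comp E E') M₁ M₂
  | op α E V, E' => .op α (comp E E') V
  | handle E M₀ H, E' => .handle (comp E E') M₀ H

theorem plug_comp (E E' : Ctx n) (M : Term n) : (E.comp E').plug M = E.plug (E'.plug M) := by
  induction E <;> simp_all [comp, plug]

theorem IsEval.comp {E E' : Ctx n} (h : E.IsEval) (h' : E'.IsEval) : (E.comp E').IsEval := by
  induction h with
  | hole => exact h'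
  | appL _ ih => exact .appL ih
  | appR hV _ ih => exact .appR hV ih
  | ite _ ih => exact .ite ih
  | op _ hV ih => exact .op ih hV
  | handle _ ih => exact .handle ih

theorem not_noHandler_comp_handle (E F : Ctx n) (M₀ : Term n) (H : Fin n → Term n) :
    ¬ (E.comp (.handle F M₀ H)).NoHandler := by
  induction E <;> simp_all [comp, NoHandler]

/-- The displayed handler is the innermost one around the hole, because `F` and `F'` have none
there. This makes the handler that catches an effect unique. -/
theorem comp_handle_inj {E E' F F' : Ctx n} {M₀ M₀' : Term n} {H H' : Fin n → Term n}
    (hF : F.NoHandler) (hF' : F'.NoHandler)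
    (h : E.comp (.handle F M₀ H) = E'.comp (.handle F' M₀' H')) :
    E = E' ∧ F = F' ∧ M₀ = M₀' ∧ H = H' := by
  induction E generalizing E' with
  | hole =>
    cases E' <;> simp only [comp, handle.injEq, reduceCtorEq] at h
    · simp [h]
    · exact absurd (h.1 ▸ hF) (not_noHandler_comp_handle _ _ _ _)
  | handle E N K ih =>
    cases E' <;> simp only [comp, handle.injEq, reduceCtorEq] at h
    · exact absurd (h.1 ▸ hF') (not_noHandler_comp_handle _ _ _ _)
    · obtain ⟨rfl, h'⟩ := ih h.1
      simp [h, h']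
  | _ =>
    cases E' <;> simp only [comp, reduceCtorEq] at h
    grind

theorem plug_ne_fail {E : Ctx n} {M : Term n} (h : M ≠ .fail) : E.plug M ≠ .fail := by
  cases E <;> simp [plug, h]

end Ctx

/-! ### Unique decomposition and determinism -/

section Determinism

variable {n : ℕ} {m : Mode}

/-- The expressions that occupy the hole of the evaluation context in the next step: redexes,
where an effect invocation stands for the innermost handler redex around it. -/
inductive Atom : Term n → Prop
  | fail : Atom .fail
  | beta {M V : Term n} : IsValue V → Atom (.app (.lam M) V)
  | iteTrue {M₁ M₂ : Term n} : Atom (.ite .tt M₁ M₂)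
  | iteFalse {M₁ M₂ : Term n} : Atom (.ite .ff M₁ M₂)
  | fix {M : Term n} : Atom (.fix M)
  | ret {V M₀ : Term n} {H : Fin n → Term n} : IsValue V → Atom (.handle V M₀ H)
  | op {α : Fin n} {V₁ V₂ : Term n} : IsValue V₁ → IsValue V₂ → Atom (.op α V₁ V₂)

theorem Atom.not_isValue_plug {a : Term n} (ha : Atom a) (E : Ctx n) : ¬ IsValue (E.plug a) := by
  intro h
  cases E
  case hole => cases ha <;> cases h
  all_goals cases h

/-- The immediate subterms of an atom in hole position are values, and a term with an atom plugged
into it is never a value. -/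
theorem Atom.eq_hole {a b : Term n} (ha : Atom a) (hb : Atom b) {E : Ctx n}
    (h : a = E.plug b) : E = .hole := by
  have key {V : Term n} (hV : IsValue V) (E : Ctx n) : V ≠ E.plug b :=
    fun h => hb.not_isValue_plug E (h ▸ hV)
  cases ha <;> cases E <;> simp only [Ctx.plug, reduceCtorEq, app.injEq, ite.injEq, op.injEq,
    handle.injEq] at h ⊢
  case beta.appL => exact key (.lam _) _ h.1
  case beta.appR hV _ _ => exact key hV _ h.2
  case iteTrue.ite => exact key .tt _ h.1
  case iteFalse.ite => exact key .ff _ h.1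
  case ret.handle hV _ _ _ => exact key hV _ h.1
  case op.op h₁ _ _ _ _ => exact key h₁ _ h.2.1

/-- Unique decomposition. The only clash between distinct frames is `appL` against `appR`, where a
value would have to contain an atom in hole position. -/
theorem Atom.plug_inj {a a' : Term n} (ha : Atom a) (ha' : Atom a') {E E' : Ctx n}
    (hE : E.IsEval) (hE' : E'.IsEval) (h : E.plug a = E'.plug a') : E = E' ∧ a = a' := by
  induction hE generalizing E' with
  | hole =>
    obtain rfl := ha.eq_hole ha' h
    exact ⟨rfl, h⟩
  | appL hE ih =>
    cases hE' with
    | hole => exact absurd (ha'.eq_hole ha h.symm) (by simp)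
    | appL hE' =>
      simp only [Ctx.plug, app.injEq] at h
      obtain ⟨rfl, rfl⟩ := ih hE' h.1
      simp [h]
    | appR hV =>
      simp only [Ctx.plug, app.injEq] at h
      exact absurd (h.1 ▸ hV) (ha.not_isValue_plug _)
    | _ => simp [Ctx.plug] at h
  | appR hV hE ih =>
    cases hE' with
    | hole => exact absurd (ha'.eq_hole ha h.symm) (by simp)
    | appL hE' =>
      simp only [Ctx.plug, app.injEq] at h
      exact absurd (h.1 ▸ hV) (ha'.not_isValue_plug _)
    | appR _ hE' =>
      simp only [Ctx.plug, app.injEq] at h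
      obtain ⟨rfl, rfl⟩ := ih hE' h.2
      simp [h]
    | _ => simp [Ctx.plug] at h
  | ite hE ih | handle hE ih | op hE _ ih =>
    cases hE' with
    | hole => exact absurd (ha'.eq_hole ha h.symm) (by simp)
    | ite hE' | handle hE' | op hE' =>
      simp only [Ctx.plug, ite.injEq, handle.injEq, op.injEq, reduceCtorEq] at h
      all_goals
        obtain ⟨rfl, rfl⟩ := ih hE' (by simp [h])
        simp [h]
    | _ => simp [Ctx.plug] at h

/-- `Next m E a N`: the expression `E[a]`, where `a` is an atom, reduces to `N`. -/
inductive Next (m : Mode) : Ctx n → Term n → Term n → Prop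
  | fail {E : Ctx n} : Next m E .fail .fail
  | beta {E : Ctx n} {M V : Term n} :
      IsValue V → Next m E (.app (.lam M) V) (E.plug (M.subst (single V)))
  | iteTrue {E : Ctx n} {M₁ M₂ : Term n} : Next m E (.ite .tt M₁ M₂) (E.plug M₁)
  | iteFalse {E : Ctx n} {M₁ M₂ : Term n} : Next m E (.ite .ff M₁ M₂) (E.plug M₂)
  | fix {E : Ctx n} {M : Term n} :
      Next m E (.fix M) (E.plug (.lam (M.subst (liftSub (single (.fix M))))))
  | ret {E : Ctx n} {V M₀ : Term n} {H : Fin n → Term n} :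
      IsValue V → Next m E (.handle V M₀ H) (E.plug (M₀.subst (single V)))
  | op {C E F : Ctx n} {α : Fin n} {V₁ V₂ M₀ : Term n} {H : Fin n → Term n} :
      C = E.comp (.handle F M₀ H) → F.NoHandler → IsValue V₁ → IsValue V₂ →
      Next m C (.op α V₁ V₂) (E.plug ((H α).subst (double (resumption m F V₂ M₀ H) V₁)))

theorem Next.atom {E : Ctx n} {a N : Term n} (h : Next m E a N) : Atom a := by
  cases h <;> constructor <;> assumption

theorem Next.unique {E : Ctx n} {a N N' : Term n} (h : Next m E a N) (h' : Next m E a N') :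
    N = N' := by
  cases h with
  | op hC hF =>
    cases h' with
    | op hC' hF' =>
      obtain ⟨rfl, rfl, rfl, rfl⟩ := Ctx.comp_handle_inj hF hF' (hC.symm.trans hC')
      rfl
  | _ => cases h'; rfl

theorem Red.exists_next {M N : Term n} (h : Red m M N) :
    ∃ E a, E.IsEval ∧ M = Ctx.plug E a ∧ Next m E a N := by
  cases h with
  | fail hE => exact ⟨_, _, hE, rfl, .fail⟩
  | @step E _ _ hE h =>
    cases h with
    | beta hV => exact ⟨_, _, hE, rfl, .beta hV⟩
    | iteTrue => exact ⟨_, _, hE, rfl, .iteTrue⟩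
    | iteFalse => exact ⟨_, _, hE, rfl, .iteFalse⟩
    | fix => exact ⟨_, _, hE, rfl, .fix⟩
    | ret hV => exact ⟨_, _, hE, rfl, .ret hV⟩
    -- The atom is the invocation alone; the handler and `F` move into the context.
    | @eff F α V₁ V₂ M₀ H hF hF' h₁ h₂ =>
      exact ⟨E.comp (.handle F M₀ H), .op α V₁ V₂, hE.comp (.handle hF),
        by simp [Ctx.plug_comp, Ctx.plug], .op rfl hF' h₁ h₂⟩

theorem Red.deterministic {M N N' : Term n} (h : Red m M N) (h' : Red m M N') : N = N' := by
  obtain ⟨E, a, hE, rfl, hN⟩ := h.exists_next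
  obtain ⟨E', a', hE', he, hN'⟩ := h'.exists_next
  obtain ⟨rfl, rfl⟩ := hN.atom.plug_inj hN'.atom hE hE' he
  exact hN.unique hN'

end Determinism

/-! ### Contraction in context -/

section Steps

variable {n : ℕ} {m : Mode}

/-- The reduction steps that do not propagate `fail`. -/
inductive Step (m : Mode) : Term n → Term n → Prop
  | mk {E : Ctx n} {M N : Term n} : E.IsEval → Contract m M N → Step m (E.plug M) (E.plug N)

theorem Step.red {M N : Term n} (h : Step m M N) : Red m M N := by
  cases h with
  | mk hE h => exact .step hE h

/-- This fails for `Red`: propagating `fail` erases the whole context, so the step does not commute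
with a further surrounding context. -/
theorem Step.plug {M N : Term n} (h : Step m M N) {E : Ctx n} (hE : E.IsEval) :
    Step m (E.plug M) (E.plug N) := by
  cases h with
  | mk hE' h =>
    rw [← Ctx.plug_comp, ← Ctx.plug_comp]
    exact .mk (hE.comp hE') h

/-- Finitely many reduction steps that do not propagate `fail`. -/
def Steps (m : Mode) : Term n → Term n → Prop := Relation.ReflTransGen (Step m)

theorem Steps.refl (M : Term n) : Steps m M M := Relation.ReflTransGen.refl

theorem Steps.trans {L M N : Term n} (h : Steps m L M) (h' : Steps m M N) : Steps m L N :=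
  Relation.ReflTransGen.trans h h'

theorem Contract.step {M N : Term n} (h : Contract m M N) : Step m M N :=
  .mk (E := .hole) .hole h

theorem Contract.steps {M N : Term n} (h : Contract m M N) : Steps m M N :=
  Relation.ReflTransGen.single h.step

theorem Steps.plug {M N : Term n} (h : Steps m M N) {E : Ctx n} (hE : E.IsEval) :
    Steps m (E.plug M) (E.plug N) :=
  Relation.ReflTransGen.lift _ (fun _ _ h => h.plug hE) _ _ h

theorem Steps.appL {M M' : Term n} (h : Steps m M M') (N : Term n) :
    Steps m (.app M N) (.app M' N) := h.plug (E := .appL .hole N) (.appL .hole)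

theorem Steps.appR {V N N' : Term n} (hV : IsValue V) (h : Steps m N N') :
    Steps m (.app V N) (.app V N') := h.plug (E := .appR V .hole) (.appR hV .hole)

theorem Steps.ite {M M' : Term n} (h : Steps m M M') (M₁ M₂ : Term n) :
    Steps m (.ite M M₁ M₂) (.ite M' M₁ M₂) := h.plug (E := .ite .hole M₁ M₂) (.ite .hole)

theorem Steps.handle {M M' : Term n} (h : Steps m M M') (M₀ : Term n) (H : Fin n → Term n) :
    Steps m (.handle M M₀ H) (.handle M' M₀ H) :=
  h.plug (E := .handle .hole M₀ H) (.handle .hole)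

theorem Steps.beta {M V N : Term n} (hV : IsValue V) (h : M.subst (single V) = N) :
    Steps m (.app (.lam M) V) N := h ▸ (Contract.beta hV).steps

theorem Steps.eff {α : Fin n} {V₁ V₂ M₀ N : Term n} {H : Fin n → Term n} (h₁ : IsValue V₁)
    (h₂ : IsValue V₂) (h : (H α).subst (double (resumption m .hole V₂ M₀ H) V₁) = N) :
    Steps m (.handle (.op α V₁ V₂) M₀ H) N :=
  h ▸ (Contract.eff (F := .hole) .hole trivial h₁ h₂).steps

/-- `M` reduces to `fail` in exactly `k` steps. -/
def ReachesIn (m : Mode) : ℕ → Term n → Prop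
  | 0, M => M = .fail
  | k + 1, M => ∃ N, Red m M N ∧ ReachesIn m k N

theorem Reaches.exists_reachesIn {M : Term n} (h : Reaches m M) : ∃ k, ReachesIn m k M := by
  induction h using Relation.ReflTransGen.head_induction_on with
  | refl => exact ⟨0, rfl⟩
  | head h _ ih =>
    obtain ⟨k, hk⟩ := ih
    exact ⟨k + 1, _, h, hk⟩

theorem red_fail : Red m (.fail : Term n) .fail := .fail (E := .hole) .hole

/-- `fail` reduces to itself through the empty context, so a run can be padded and the step count
acts as an upper bound. -/
theorem ReachesIn.succ {k : ℕ} {M : Term n} (h : ReachesIn m k M) : ReachesIn m (k + 1) M := by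
  induction k generalizing M with
  | zero => exact ⟨.fail, by cases h; exact red_fail, rfl⟩
  | succ k ih =>
    obtain ⟨N, hN, h⟩ := h
    exact ⟨N, hN, ih h⟩

theorem ReachesIn.of_red_succ {k : ℕ} {M N : Term n} (h : ReachesIn m (k + 1) M)
    (hN : Red m M N) : ReachesIn m k N := by
  obtain ⟨N', hN', h⟩ := h
  rwa [hN.deterministic hN']

/-- By determinism the run to `fail` passes through `N`; the bound `k` is kept instead of being
lowered. -/
theorem ReachesIn.of_steps {k : ℕ} {M N : Term n} (h : ReachesIn m k M) (hN : Steps m M N) :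
    ReachesIn m k N := by
  unfold Steps at hN
  induction hN with
  | refl => exact h
  | tail _ hs ih => exact ih.succ.of_red_succ hs.red

theorem Steps.reds {M N : Term n} (h : Steps m M N) : Relation.ReflTransGen (Red m) M N :=
  Relation.ReflTransGen.mono (fun _ _ => Step.red) _ _ h

end Steps

/-! ### Words as effectful computations -/

section Words

variable {n : ℕ} (m : Mode) (A : Sig n) (e : Bool → Fin n)

/-- `Emits m e w M`: the computation `M` performs the effects `e b` for the letters `b` of `w`, one
after the other, and then returns. -/
inductive Emits : List Bool → Term n → Prop
  | nil {M : Term n} : Steps m M .unit → Emits [] M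
  | cons {b : Bool} {w : List Bool} {M V : Term n} : Steps m M (.op (e b) .unit V) →
      IsValue V → Emits w (.app V .unit) → Emits (b :: w) M

/-- The value `V` represents the word `w`. -/
structure Represents (w : List Bool) (V : Term n) : Prop where
  isValue : IsValue V
  emits : Emits m e w (.app V .unit)

/-- The type of words. -/
def wordTy : Ty := .arrow (.base .unit) (.base .unit)

/-- The empty word. -/
def nilT : Term n := .lam .unit

/-- The function that puts the letter `b` in front of a word. -/
def push (b : Bool) : Term n := .lam (.lam (.op (e b) .unit (.var 1)))

/-- The handler clauses of `hd`. -/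
def hdClauses (α : Fin n) : Term n := if α = e true then .tt else .ff

/-- The function that tells whether the first letter of a word is `true`. -/
def hd : Term n := .lam (.handle (.app (.var 0) .unit) .ff (hdClauses e))

/-- The handler clauses of `tl`. The shallow clause returns the continuation. The deep clause
returns a function that performs the effect only on the argument `false`. -/
def tlClauses (α : Fin n) : Term n :=
  if α = e true ∨ α = e false then
    match m with
    | .shallow => .var 0
    | .deep => .lam (.ite (.var 0) (.app (.app (.var 1) .unit) .ff)
        (.op α .unit (.lam (.app (.app (.var 2) .unit) .ff))))
  else .fail

/-- The function that removes the first letter of a word. -/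
def tl : Term n :=
  match m with
  | .shallow => .lam (.handle (.app (.var 0) .unit) nilT (tlClauses .shallow e))
  | .deep => .lam (.lam (.app
      (.handle (.app (.var 1) .unit) (.lam .unit) (tlClauses .deep e)) .tt))

variable {A e}

/-! ### Typing and substitution for the word operations -/

theorem nilT_hasType (Γ : List Ty) : HasType m A Γ nilT wordTy := .lam .unit

variable {m}

theorem HasType.op_unit {Γ : List Ty} {α : Fin n} {V : Term n} {σ : Ty}
    (hα : A α = (.unit, .unit)) (hV : IsArg V)
    (h : HasType m A Γ V (.arrow (.base .unit) σ)) : HasType m A Γ (.op α .unit V) σ := by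
  refine .op (.val .unit) hV ?_ ?_ <;> rw [hα]
  exacts [.unit, h]

theorem push_hasType (hA : ∀ b, A (e b) = (.unit, .unit)) (b : Bool) :
    HasType m A [] (push e b) (.arrow wordTy wordTy) :=
  .lam (.lam (.op_unit (hA b) (.var 1) (.var rfl)))

theorem hdClauses_hasType (Γ : List Ty) (α : Fin n) :
    HasType m A Γ (hdClauses e α) (.base .bool) := by
  unfold hdClauses; split
  exacts [.tt, .ff]

theorem hd_hasType : HasType m A [] (hd e) (.arrow wordTy (.base .bool)) :=
  .lam (.handle (σ₁ := .base .unit) .ff (fun α => hdClauses_hasType _ α) (.app (.var rfl) .unit))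

theorem tlClauses_shallow_hasType (hA : ∀ b, A (e b) = (.unit, .unit)) (Γ : List Ty)
    (α : Fin n) : HasType .shallow A
      (.arrow (.base (A α).2) (.base .unit) :: .base (A α).1 :: Γ)
      (tlClauses .shallow e α) wordTy := by
  unfold tlClauses
  split
  next h =>
    refine .var ?_
    rcases h with rfl | rfl <;> simp [hA, wordTy]
  next => exact .fail

theorem tlClauses_deep_hasType (hA : ∀ b, A (e b) = (.unit, .unit)) (Γ : List Ty)
    (α : Fin n) : HasType .deep A
      (.arrow (.base (A α).2) (.arrow (.base .bool) (.base .unit)) :: .base (A α).1 :: Γ)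
      (tlClauses .deep e α) (.arrow (.base .bool) (.base .unit)) := by
  unfold tlClauses
  split
  next h =>
    have hα : A α = (.unit, .unit) := by rcases h with rfl | rfl <;> exact hA _
    rw [hα]
    exact .lam (.ite (.var rfl) (.app (.app (.var rfl) .unit) .ff)
      (.op_unit hα (.val (.lam _)) (.lam (.app (.app (.var rfl) .unit) .ff))))
  next => exact .fail

theorem tl_hasType (hA : ∀ b, A (e b) = (.unit, .unit)) :
    HasType m A [] (tl m e) (.arrow wordTy wordTy) := by
  cases m with
  | shallow =>
    exact .lam (.handle (σ₁ := .base .unit) (nilT_hasType _ _)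
      (fun α => tlClauses_shallow_hasType hA _ α) (.app (.var rfl) .unit))
  | deep =>
    exact .lam (.lam (.app (.handle (σ₁ := .base .unit) (.lam .unit)
      (fun α => tlClauses_deep_hasType hA _ α) (.app (.var rfl) .unit)) .tt))

theorem tlClauses_shallow (b : Bool) : tlClauses .shallow e (e b) = .var 0 := by
  cases b <;> simp [tlClauses]

theorem tlClauses_deep (b : Bool) :
    tlClauses .deep e (e b) = .lam (.ite (.var 0) (.app (.app (.var 1) .unit) .ff)
      (.op (e b) .unit (.lam (.app (.app (.var 2) .unit) .ff)))) := by
  cases b <;> simp [tlClauses]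

theorem hdClauses_subst (α : Fin n) (s : ℕ → Term n) :
    (hdClauses e α).subst s = hdClauses e α := by
  unfold hdClauses; split <;> rfl

theorem tlClauses_subst (α : Fin n) (s : ℕ → Term n) :
    (tlClauses m e α).subst (liftSub (liftSub s)) = tlClauses m e α := by
  unfold tlClauses
  split
  · cases m <;> rfl
  · rfl

theorem tlClauses_rename (α : Fin n) (ξ : ℕ → ℕ) :
    (tlClauses m e α).rename (liftRen (liftRen ξ)) = tlClauses m e α := by
  unfold tlClauses
  split
  · cases m <;> rfl
  · rfl

/-! ### Correctness of the word operations -/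

theorem Emits.of_steps {w : List Bool} {M N : Term n} (h : Steps m M N) (hN : Emits m e w N) :
    Emits m e w M := by
  cases hN with
  | nil h' => exact .nil (h.trans h')
  | cons h' hV hw => exact .cons (h.trans h') hV hw

theorem Represents.nilT : Represents m e [] (nilT : Term n) :=
  ⟨.lam _, .nil (.beta .unit rfl)⟩

theorem Represents.push {w : List Bool} {V : Term n} (h : Represents m e w V) (b : Bool) :
    ∃ V', Represents m e (b :: w) V' ∧ Steps m (.app (push e b) V) V' :=
  ⟨.lam (.op (e b) .unit (V.rename Nat.succ)),
    ⟨.lam _, .cons (.beta .unit (by simp [subst])) h.isValue h.emits⟩,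
    .beta h.isValue (by simp [subst, liftSub, single])⟩

/-- The truth value `b`. -/
def boolT (b : Bool) : Term n := if b then .tt else .ff

/-- The clause for the first effect drops the continuation, so later letters are never performed.
The return clause supplies the default `false` on the empty word. -/
theorem Represents.hd (he : Function.Injective e) {w : List Bool} {V : Term n}
    (h : Represents m e w V) : Steps m (.app (hd e) V) (boolT (w.headD false)) := by
  have h₁ : Steps m (.app (BPCFAE.hd e) V) (.handle (.app V .unit) .ff (hdClauses e)) :=
    .beta h.isValue (by simp [subst, hdClauses_subst])
  refine h₁.trans ?_
  cases h.emits with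
  | nil hs => exact (hs.handle _ _).trans (Contract.ret .unit).steps
  | @cons b _ _ _ hs hV _ =>
    refine (hs.handle _ _).trans (.eff .unit hV ?_)
    rw [hdClauses_subst]
    simp only [hdClauses, he.eq_iff]
    rfl

/-- On the argument `ff` every clause performs its effect again, now outside the handler, and passes
`ff` to the resumption. The deep handler thus acts as the identity on words. -/
theorem Emits.deep_fold {w : List Bool} {M : Term n} (h : Emits .deep e w M) :
    Emits .deep e w (.app (.handle M (.lam .unit) (tlClauses .deep e)) .ff) := by
  induction h with
  | nil h =>
    refine .nil ((((h.handle _ _).trans (Contract.ret .unit).steps).appL _).trans ?_)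
    exact .beta .ff rfl
  | @cons b w M V h hV hw ih =>
    refine .cons (V := .lam (.app (.app ((resumption .deep .hole V (.lam .unit)
      (tlClauses .deep e)).rename Nat.succ) .unit) .ff)) ?_ (.lam _) ?_
    · refine (((h.handle _ _).trans (.eff .unit hV rfl)).appL _).trans ?_
      rw [tlClauses_deep]
      exact (Steps.beta .ff rfl).trans
        (Contract.iteFalse.steps.trans (by
          simp [subst]
          exact .refl _))
    · refine .of_steps (.beta .unit rfl) (.of_steps ?_ ih)
      simp only [subst, rename_succ_subst_single]
      refine (Steps.beta .unit ?_).appL _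
      simp [subst, Ctx.rename, Ctx.plug, tlClauses_rename, tlClauses_subst, rename]

theorem Represents.tl {w : List Bool} {V : Term n} (h : Represents m e w V) :
    ∃ V', Represents m e w.tail V' ∧ Steps m (.app (tl m e) V) V' := by
  cases m with
  | shallow =>
    have h₁ : Steps .shallow (.app (BPCFAE.tl .shallow e) V)
        (.handle (.app V .unit) BPCFAE.nilT (tlClauses .shallow e)) :=
      .beta h.isValue (by simp [subst, tlClauses_subst, BPCFAE.nilT])
    cases h.emits with
    | nil hs =>
      exact ⟨_, .nilT, h₁.trans ((hs.handle _ _).trans (Contract.ret .unit).steps)⟩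
    | @cons b w _ V' hs hV hw =>
      refine ⟨_, ⟨.lam _, ?_⟩, h₁.trans ((hs.handle _ _).trans (.eff .unit hV
        (by rw [tlClauses_shallow]; rfl)))⟩
      exact .of_steps (.beta .unit (by simp [subst, Ctx.rename, Ctx.plug])) hw
  | deep =>
    refine ⟨.lam (.app (.handle (.app (V.rename Nat.succ) .unit) (.lam .unit)
      (tlClauses .deep e)) .tt), ⟨.lam _, ?_⟩,
      .beta h.isValue (by simp [subst, tlClauses_subst])⟩
    refine .of_steps (.beta .unit rfl) ?_
    simp only [subst, rename_succ_subst_single, tlClauses_subst]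
    cases h.emits with
    | nil hs =>
      refine .nil ((((hs.handle _ _).trans (Contract.ret .unit).steps).appL _).trans ?_)
      exact .beta .tt rfl
    | @cons b w _ V' hs hV hw =>
      -- The argument `tt` skips this first effect and hands `ff` to the resumption, which leaves
      -- the situation of `Emits.deep_fold` for the rest.
      refine .of_steps ((((hs.handle _ _).trans (.eff .unit hV rfl)).appL _).trans ?_)
        hw.deep_fold
      rw [tlClauses_deep]
      refine (Steps.beta .tt rfl).trans (Contract.iteTrue.steps.trans ?_)
      simp only [subst, liftSub_one, double_zero, rename_succ_subst_single]
      refine (Steps.beta .unit ?_).appL _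
      simp [subst, Ctx.rename, Ctx.plug, tlClauses_rename, tlClauses_subst, rename]

end Words

/-! ### Compiling partial recursive functions on lists -/

/-- The word that represents a list of natural numbers. -/
def word : List ℕ → List Bool
  | [] => []
  | k :: l => List.replicate k true ++ false :: word l

/-- The empty list is treated as having head `0` and empty tail. Allowing the remainder `r` to be
empty covers it together with the nonempty lists. -/
theorem word_eq (l : List ℕ) : ∃ r : List Bool,
    word l = List.replicate l.headI true ++ r ∧ r.headD false = false ∧ r.tail = word l.tail := by
  cases l with
  | nil => exact ⟨[], rfl, rfl, rfl⟩
  | cons k l => exact ⟨false :: word l, rfl, rfl, rfl⟩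

theorem headD_word (l : List ℕ) : (word l).headD false = decide (l.headI ≠ 0) := by
  obtain _ | ⟨_ | k, l⟩ := l <;> simp [word, List.replicate_succ]

section Compile

variable {n : ℕ} (m : Mode) {A : Sig n} (e : Bool → Fin n)

/-- The body of `dropHead`, where `f` is the recursive function. -/
def dropHeadBody (f : Term n) : Term n :=
  .ite (.app (hd e) (.var 0)) (.app f (.app (tl m e) (.var 0))) (.app (tl m e) (.var 0))

/-- The recursive function that removes the first number of a list. -/
def dropHeadFix : Term n := .fix (dropHeadBody m e (.var 1))

/-- `dropHeadFix`, unfolded to a value. -/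
def dropHead : Term n := .lam (dropHeadBody m e (dropHeadFix m e))

/-- The body of `headCons`, where `f` is the recursive function. -/
def headConsBody (f : Term n) : Term n :=
  .lam (.ite (.app (hd e) (.var 1))
    (.app (push e true) (.app (.app f (.app (tl m e) (.var 1))) (.var 0)))
    (.app (push e false) (.var 0)))

/-- The recursive function that puts the first number of a list in front of another list. -/
def headConsFix : Term n := .fix (headConsBody m e (.var 2))

/-- `headConsFix`, unfolded to a value. -/
def headCons : Term n := .lam (headConsBody m e (headConsFix m e))

/-- The function that calls the recursive function `f` on the tail of the given list if the head is
nonzero, and returns the tail otherwise. -/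
def whileTest (f : Term n) : Term n :=
  .lam (.ite (.app (hd e) (.var 0)) (.app f (.app (dropHead m e) (.var 0)))
    (.app (dropHead m e) (.var 0)))

/-- The recursive function that iterates `F` until the head of the result is zero. -/
def whileFix (F : Term n) : Term n :=
  .fix (.app (whileTest m e (.var 2)) (.app F (.var 0)))

/-- `whileFix`, unfolded to a value. -/
def while' (F : Term n) : Term n :=
  .lam (.app (whileTest m e (whileFix m e F)) (.app F (.var 0)))

open Turing.ToPartrec in
/-- The function on words that implements a partial recursive function on lists. -/
def compile : Code → Term n
  | .zero' => push e false
  | .succ => .lam (.app (push e true) (.app (.app (headCons m e) (.var 0)) nilT))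
  | .tail => dropHead m e
  | .cons f fs =>
    .lam (.app (.app (headCons m e) (.app (compile f) (.var 0))) (.app (compile fs) (.var 0)))
  | .comp f g => .lam (.app (compile f) (.app (compile g) (.var 0)))
  | .case f g =>
    .lam (.ite (.app (hd e) (.var 0)) (.app (compile g) (.app (tl m e) (.var 0)))
      (.app (compile f) (.app (dropHead m e) (.var 0))))
  | .fix f => while' m e (compile f)

variable {m e}

/-! ### Typing of compiled programs -/

theorem dropHeadBody_hasType (hA : ∀ b, A (e b) = (.unit, .unit)) {Γ : List Ty} {f : Term n}
    (hf : HasType m A (wordTy :: Γ) f (.arrow wordTy wordTy)) :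
    HasType m A (wordTy :: Γ) (dropHeadBody m e f) wordTy :=
  .ite (.app (hd_hasType.weaken _) (.var rfl)) (.app hf (.app ((tl_hasType hA).weaken _) (.var rfl)))
    (.app ((tl_hasType hA).weaken _) (.var rfl))

theorem dropHeadFix_hasType (hA : ∀ b, A (e b) = (.unit, .unit)) :
    HasType m A [] (dropHeadFix m e) (.arrow wordTy wordTy) :=
  .fix (dropHeadBody_hasType hA (.var rfl))

theorem dropHead_hasType (hA : ∀ b, A (e b) = (.unit, .unit)) :
    HasType m A [] (dropHead m e) (.arrow wordTy wordTy) :=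
  .lam (dropHeadBody_hasType hA ((dropHeadFix_hasType hA).weaken _))

theorem headConsBody_hasType (hA : ∀ b, A (e b) = (.unit, .unit)) {Γ : List Ty} {f : Term n}
    (hf : HasType m A (wordTy :: wordTy :: Γ) f (.arrow wordTy (.arrow wordTy wordTy))) :
    HasType m A (wordTy :: Γ) (headConsBody m e f) (.arrow wordTy wordTy) :=
  .lam (.ite (.app (hd_hasType.weaken _) (.var rfl))
    (.app ((push_hasType hA _).weaken _)
      (.app (.app hf (.app ((tl_hasType hA).weaken _) (.var rfl))) (.var rfl)))
    (.app ((push_hasType hA _).weaken _) (.var rfl)))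

theorem headConsFix_hasType (hA : ∀ b, A (e b) = (.unit, .unit)) :
    HasType m A [] (headConsFix m e) (.arrow wordTy (.arrow wordTy wordTy)) :=
  .fix (headConsBody_hasType hA (.var rfl))

theorem headCons_hasType (hA : ∀ b, A (e b) = (.unit, .unit)) :
    HasType m A [] (headCons m e) (.arrow wordTy (.arrow wordTy wordTy)) :=
  .lam (headConsBody_hasType hA ((headConsFix_hasType hA).weaken _))

theorem whileTest_hasType (hA : ∀ b, A (e b) = (.unit, .unit)) {Γ : List Ty} {f : Term n}
    (hf : HasType m A (wordTy :: Γ) f (.arrow wordTy wordTy)) :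
    HasType m A Γ (whileTest m e f) (.arrow wordTy wordTy) :=
  .lam (.ite (.app (hd_hasType.weaken _) (.var rfl))
    (.app hf (.app ((dropHead_hasType hA).weaken _) (.var rfl)))
    (.app ((dropHead_hasType hA).weaken _) (.var rfl)))

theorem whileFix_hasType (hA : ∀ b, A (e b) = (.unit, .unit)) {F : Term n}
    (hF : HasType m A [] F (.arrow wordTy wordTy)) :
    HasType m A [] (whileFix m e F) (.arrow wordTy wordTy) :=
  .fix (.app (whileTest_hasType hA (.var rfl)) (.app (hF.weaken _) (.var rfl)))

theorem compile_hasType (hA : ∀ b, A (e b) = (.unit, .unit)) (c : Turing.ToPartrec.Code) :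
    HasType m A [] (compile m e c) (.arrow wordTy wordTy) := by
  induction c with
  | zero' => exact push_hasType hA _
  | succ =>
    exact .lam (.app ((push_hasType hA _).weaken _)
      (.app (.app ((headCons_hasType hA).weaken _) (.var rfl)) (nilT_hasType _ _)))
  | tail => exact dropHead_hasType hA
  | cons f fs hf hfs =>
    exact .lam (.app (.app ((headCons_hasType hA).weaken _) (.app (hf.weaken _) (.var rfl)))
      (.app (hfs.weaken _) (.var rfl)))
  | comp f g hf hg => exact .lam (.app (hf.weaken _) (.app (hg.weaken _) (.var rfl)))
  | case f g hf hg =>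
    exact .lam (.ite (.app (hd_hasType.weaken _) (.var rfl))
      (.app (hg.weaken _) (.app ((tl_hasType hA).weaken _) (.var rfl)))
      (.app (hf.weaken _) (.app ((dropHead_hasType hA).weaken _) (.var rfl))))
  | fix f hf =>
    exact .lam (.app (whileTest_hasType hA ((whileFix_hasType hA hf).weaken _))
      (.app (hf.weaken _) (.var rfl)))

theorem compile_isValue (c : Turing.ToPartrec.Code) : IsValue (compile m e c) := by
  cases c <;> exact .lam _

/-- The signature all of whose effects have type `unit → unit`. -/
abbrev unitSig (n : ℕ) : Sig n := fun _ => (.unit, .unit)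

/-! ### Closedness of compiled programs -/

@[simp]
theorem nilT_subst (s : ℕ → Term n) : (nilT : Term n).subst s = nilT := rfl

@[simp]
theorem push_subst (b : Bool) (s : ℕ → Term n) : (push e b).subst s = push e b := rfl

@[simp]
theorem hd_subst (s : ℕ → Term n) : (hd e).subst s = hd e :=
  (hd_hasType (m := .deep) (A := unitSig n)).closed_subst s

@[simp]
theorem tl_subst (s : ℕ → Term n) : (tl m e).subst s = tl m e :=
  (tl_hasType (A := unitSig n) fun _ => rfl).closed_subst s

@[simp]
theorem dropHeadFix_rename (ξ : ℕ → ℕ) : (dropHeadFix m e).rename ξ = dropHeadFix m e :=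
  (dropHeadFix_hasType (A := unitSig n) fun _ => rfl).closed_rename ξ

@[simp]
theorem dropHeadFix_subst (s : ℕ → Term n) : (dropHeadFix m e).subst s = dropHeadFix m e :=
  (dropHeadFix_hasType (A := unitSig n) fun _ => rfl).closed_subst s

@[simp]
theorem dropHead_subst (s : ℕ → Term n) : (dropHead m e).subst s = dropHead m e :=
  (dropHead_hasType (A := unitSig n) fun _ => rfl).closed_subst s

@[simp]
theorem headConsFix_rename (ξ : ℕ → ℕ) : (headConsFix m e).rename ξ = headConsFix m e :=
  (headConsFix_hasType (A := unitSig n) fun _ => rfl).closed_rename ξ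

@[simp]
theorem headConsFix_subst (s : ℕ → Term n) : (headConsFix m e).subst s = headConsFix m e :=
  (headConsFix_hasType (A := unitSig n) fun _ => rfl).closed_subst s

@[simp]
theorem headCons_subst (s : ℕ → Term n) : (headCons m e).subst s = headCons m e :=
  (headCons_hasType (A := unitSig n) fun _ => rfl).closed_subst s

@[simp]
theorem compile_subst (c : Turing.ToPartrec.Code) (s : ℕ → Term n) :
    (compile m e c).subst s = compile m e c :=
  (compile_hasType (A := unitSig n) (fun _ => rfl) c).closed_subst s

@[simp]
theorem whileFix_compile_rename (c : Turing.ToPartrec.Code) (ξ : ℕ → ℕ) :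
    (whileFix m e (compile m e c)).rename ξ = whileFix m e (compile m e c) :=
  (whileFix_hasType (A := unitSig n) (fun _ => rfl) (compile_hasType (fun _ => rfl) c)).closed_rename
    ξ

@[simp]
theorem whileFix_compile_subst (c : Turing.ToPartrec.Code) (s : ℕ → Term n) :
    (whileFix m e (compile m e c)).subst s = whileFix m e (compile m e c) :=
  (whileFix_hasType (A := unitSig n) (fun _ => rfl) (compile_hasType (fun _ => rfl) c)).closed_subst
    s

/-! ### Unfolding of recursion and correctness of the list operations -/

theorem dropHeadFix_steps : Steps m (dropHeadFix m e) (dropHead m e) := by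
  have h := (Contract.fix (m := m) (M := dropHeadBody m e (.var 1))).steps
  rw [← dropHeadFix] at h
  simpa [dropHeadBody, dropHead, subst] using h

theorem headConsFix_steps : Steps m (headConsFix m e) (headCons m e) := by
  have h := (Contract.fix (m := m) (M := headConsBody m e (.var 2))).steps
  rw [← headConsFix] at h
  simpa [headConsBody, headCons, subst, rename] using h

theorem whileFix_steps (c : Turing.ToPartrec.Code) :
    Steps m (whileFix m e (compile m e c)) (while' m e (compile m e c)) := by
  have h := (Contract.fix (m := m)
    (M := .app (whileTest m e (.var 2)) (.app (compile m e c) (.var 0)))).steps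
  rw [← whileFix] at h
  simpa [whileTest, while', subst] using h

theorem Steps.iteTrue {M M₁ M₂ : Term n} (h : Steps m M .tt) : Steps m (.ite M M₁ M₂) M₁ :=
  (h.ite _ _).trans Contract.iteTrue.steps

theorem Steps.iteFalse {M M₁ M₂ : Term n} (h : Steps m M .ff) : Steps m (.ite M M₁ M₂) M₂ :=
  (h.ite _ _).trans Contract.iteFalse.steps

theorem Represents.dropHead (he : Function.Injective e) {k : ℕ} {r : List Bool} {V : Term n}
    (h : Represents m e (List.replicate k true ++ r) V) (hr : r.headD false = false) :
    ∃ V', Represents m e r.tail V' ∧ Steps m (.app (dropHead m e) V) V' := by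
  have hstep : Steps m (.app (BPCFAE.dropHead m e) V)
      (.ite (.app (BPCFAE.hd e) V) (.app (dropHeadFix m e) (.app (BPCFAE.tl m e) V))
        (.app (BPCFAE.tl m e) V)) :=
    .beta h.isValue (by simp [dropHeadBody, subst])
  induction k generalizing V with
  | zero =>
    have h₁ := h.hd he
    obtain ⟨V', hV', h₂⟩ := h.tl
    simp only [List.replicate_zero, List.nil_append, hr] at h₁ hV'
    exact ⟨V', hV', hstep.trans ((Steps.iteFalse h₁).trans h₂)⟩
  | succ k ih =>
    have h₁ := h.hd he
    obtain ⟨V', hV', h₂⟩ := h.tl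
    simp only [List.replicate_succ, List.cons_append, List.headD_cons, List.tail_cons] at h₁ hV'
    obtain ⟨X, hX, h₃⟩ := ih hV' (.beta hV'.isValue (by simp [dropHeadBody, subst]))
    exact ⟨X, hX, hstep.trans ((Steps.iteTrue h₁).trans ((dropHeadFix_steps.appL _).trans
      ((h₂.appR (.lam _)).trans h₃)))⟩

/-- The value `L` is chosen before `W`, since under call-by-value the partial application is
evaluated before the second argument is known. -/
theorem Represents.headCons (he : Function.Injective e) {k : ℕ} {r : List Bool} {V : Term n}
    (h : Represents m e (List.replicate k true ++ r) V) (hr : r.headD false = false) :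
    ∃ L, IsValue L ∧ Steps m (.app (headCons m e) V) L ∧ ∀ u W, Represents m e u W →
      ∃ X, Represents m e (List.replicate k true ++ false :: u) X ∧ Steps m (.app L W) X := by
  refine ⟨.lam (.ite (.app (BPCFAE.hd e) (V.rename Nat.succ))
    (.app (BPCFAE.push e true)
      (.app (.app (headConsFix m e) (.app (BPCFAE.tl m e) (V.rename Nat.succ))) (.var 0)))
    (.app (BPCFAE.push e false) (.var 0))), .lam _,
    .beta h.isValue (by simp [headConsBody, subst]), fun u W hW => ?_⟩
  have hstep := Steps.beta (m := m) hW.isValue (M := .ite (.app (BPCFAE.hd e) (V.rename Nat.succ))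
    (.app (BPCFAE.push e true)
      (.app (.app (headConsFix m e) (.app (BPCFAE.tl m e) (V.rename Nat.succ))) (.var 0)))
    (.app (BPCFAE.push e false) (.var 0))) rfl
  simp only [subst, rename_succ_subst_single, hd_subst, tl_subst, push_subst, headConsFix_subst,
    single_zero] at hstep
  induction k generalizing V with
  | zero =>
    have h₁ := h.hd he
    obtain ⟨X, hX, h₂⟩ := hW.push false
    simp only [List.replicate_zero, List.nil_append, hr] at h₁ ⊢
    exact ⟨X, hX, hstep.trans ((Steps.iteFalse h₁).trans h₂)⟩
  | succ k ih =>
    have h₁ := h.hd he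
    obtain ⟨V', hV', h₂⟩ := h.tl
    simp only [List.replicate_succ, List.cons_append, List.headD_cons, List.tail_cons] at h₁ hV' ⊢
    obtain ⟨X, hX, h₃⟩ := ih hV' (.beta hW.isValue (by simp [subst]))
    obtain ⟨Y, hY, h₄⟩ := hX.push true
    refine ⟨Y, hY, hstep.trans ((Steps.iteTrue h₁).trans (.trans (.appR (.lam _) ?_) h₄))⟩
    refine .trans (.appL ?_ _) h₃
    exact (headConsFix_steps.appL _).trans ((h₂.appR (.lam _)).trans
      (.beta hV'.isValue (by simp [headConsBody, subst])))

/-! ### Simulation of partial functions -/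

variable (m e)

/-- `M` computes the list `p` if `p` is defined; otherwise, `M` does not reach `fail` in any
evaluation context. -/
def Computes (M : Term n) (p : Part (List ℕ)) : Prop :=
  (∀ l ∈ p, ∃ V, Represents m e (word l) V ∧ Steps m M V) ∧
    ∀ (E : Ctx n) (k : ℕ), E.IsEval → ReachesIn m k (E.plug M) → p.Dom

variable {m e}

theorem Computes.pure {M V : Term n} {l : List ℕ} (h : Represents m e (word l) V)
    (hM : Steps m M V) : Computes m e M (Pure.pure l) :=
  ⟨fun _ hl => ⟨V, Part.mem_some_iff.1 hl ▸ h, hM⟩, fun _ _ _ _ => trivial⟩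

theorem Computes.of_steps {M N : Term n} {p : Part (List ℕ)} (h : Computes m e N p)
    (hM : Steps m M N) : Computes m e M p :=
  ⟨fun l hl =>
    let ⟨V, hV, hN⟩ := h.1 l hl
    ⟨V, hV, hM.trans hN⟩,
    fun E k hE hk => h.2 E k hE (hk.of_steps (hM.plug hE))⟩

/-- The quantification over all contexts in `Computes` is what lets `C` be absorbed: the clause for
`N` is used in `E.comp C`. -/
theorem Computes.bind {N : Term n} {p : Part (List ℕ)} {q : List ℕ → Part (List ℕ)} (C : Ctx n)
    (hC : C.IsEval) (h : Computes m e N p)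
    (hq : ∀ l V, Represents m e (word l) V → Computes m e (C.plug V) (q l)) :
    Computes m e (C.plug N) (p >>= q) := by
  refine ⟨fun u hu => ?_, fun E k hE hk => ?_⟩
  · obtain ⟨l, hl, hu⟩ := Part.mem_bind_iff.1 hu
    obtain ⟨V, hV, hN⟩ := h.1 l hl
    obtain ⟨W, hW, hV⟩ := (hq l V hV).1 u hu
    exact ⟨W, hW, (hN.plug hC).trans hV⟩
  · have hp := h.2 (E.comp C) k (hE.comp hC) (by rwa [Ctx.plug_comp])
    obtain ⟨V, hV, hN⟩ := h.1 _ (Part.get_mem hp)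
    exact Part.dom_iff_mem.2 (by
      obtain ⟨u, hu⟩ := Part.dom_iff_mem.1
        ((hq _ V hV).2 E k hE (hk.of_steps ((hN.plug hC).plug hE)))
      exact ⟨u, Part.mem_bind_iff.2 ⟨_, Part.get_mem hp, hu⟩⟩)

/-- `F` implements the partial function `f` on lists. -/
def Implements (m : Mode) (e : Bool → Fin n) (F : Term n) (f : List ℕ →. List ℕ) : Prop :=
  ∀ l V, Represents m e (word l) V → Computes m e (.app F V) (f l)

theorem Represents.dropHead_word (he : Function.Injective e) {l : List ℕ} {V : Term n}
    (h : Represents m e (word l) V) :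
    ∃ V', Represents m e (word l.tail) V' ∧ Steps m (.app (BPCFAE.dropHead m e) V) V' := by
  obtain ⟨r, hr, hr', ht⟩ := word_eq l
  rw [hr] at h
  exact ht ▸ h.dropHead he hr'

theorem Represents.headCons_word (he : Function.Injective e) {l : List ℕ} {V : Term n}
    (h : Represents m e (word l) V) :
    ∃ L, IsValue L ∧ Steps m (.app (BPCFAE.headCons m e) V) L ∧ ∀ u W, Represents m e (word u) W →
      ∃ X, Represents m e (word (l.headI :: u)) X ∧ Steps m (.app L W) X := by
  obtain ⟨r, hr, hr', -⟩ := word_eq l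
  rw [hr] at h
  obtain ⟨L, hL, hs, hX⟩ := h.headCons he hr'
  exact ⟨L, hL, hs, fun u W hW => hX _ _ hW⟩

theorem Represents.hd_word (he : Function.Injective e) {l : List ℕ} {V : Term n}
    (h : Represents m e (word l) V) :
    Steps m (.app (BPCFAE.hd e) V) (if l.headI = 0 then .ff else .tt) := by
  have := h.hd he
  rw [headD_word] at this
  by_cases hl : l.headI = 0 <;> simpa [hl, boolT] using this

theorem while'_steps (he : Function.Injective e) (c : Turing.ToPartrec.Code) {l : List ℕ}
    {V : Term n} (h : Represents m e (word l) V) :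
    ∃ X, Represents m e (word l.tail) X ∧
      Steps m (.app (whileTest m e (whileFix m e (compile m e c))) V)
        (if l.headI = 0 then X else .app (while' m e (compile m e c)) X) := by
  obtain ⟨X, hX, hs⟩ := h.dropHead_word he
  have h₁ := h.hd_word he
  refine ⟨X, hX, .trans (.beta h.isValue rfl) ?_⟩
  simp only [subst, hd_subst, single_zero, whileFix_compile_subst, dropHead_subst]
  split at h₁
  next hl => simpa [hl] using (Steps.iteFalse h₁).trans hs
  next hl =>
    simpa [hl] using (Steps.iteTrue h₁).trans (((whileFix_steps c).appL _).trans
      (hs.appR (.lam _)))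

theorem implements_while' (he : Function.Injective e) (c : Turing.ToPartrec.Code)
    (h : Implements m e (compile m e c) c.eval) :
    Implements m e (while' m e (compile m e c)) c.fix.eval := by
  -- A single `Step` instead of `Steps`, so that each iteration strictly lowers the step count
  -- below.
  have hstep {V : Term n} (hV : IsValue V) : Step m (.app (while' m e (compile m e c)) V)
      (.app (whileTest m e (whileFix m e (compile m e c))) (.app (compile m e c) V)) := by
    have := (Contract.beta (m := m) (M := .app (whileTest m e (whileFix m e (compile m e c)))
      (.app (compile m e c) (.var 0))) hV).step
    simpa [subst, whileTest, while'] using this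
  rw [Turing.ToPartrec.Code.fix_eval]
  intro l V hV
  refine ⟨fun u hu => ?_, fun E k hE hk => ?_⟩
  · refine PFun.fixInduction' (C := fun l => ∀ V, Represents m e (word l) V →
      ∃ X, Represents m e (word u) X ∧ Steps m (.app (while' m e (compile m e c)) V) X) hu
      (fun l hl V hV => ?_) (fun l l' _ hl ih V hV => ?_) V hV
    · obtain ⟨r, hr, hru⟩ := (Part.mem_map_iff _).1 hl
      obtain ⟨W, hW, hs⟩ := (h l V hV).1 r hr
      obtain ⟨X, hX, hs'⟩ := while'_steps he c hW
      split_ifs at hru hs' with h0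
      cases hru
      exact ⟨X, hX, .head (hstep hV.isValue) ((hs.appR (.lam _)).trans hs')⟩
    · obtain ⟨r, hr, hru⟩ := (Part.mem_map_iff _).1 hl
      obtain ⟨W, hW, hs⟩ := (h l V hV).1 r hr
      obtain ⟨X, hX, hs'⟩ := while'_steps he c hW
      split_ifs at hru hs' with h0
      cases hru
      obtain ⟨Y, hY, hs''⟩ := ih X hX
      exact ⟨Y, hY, .head (hstep hV.isValue) ((hs.appR (.lam _)).trans (hs'.trans hs''))⟩
  -- Induction on the length of the run to `fail`, which bounds the number of iterations.
  · induction k generalizing l V with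
    | zero => exact absurd hk (Ctx.plug_ne_fail (by simp))
    | succ k ih =>
      have hk := hk.of_red_succ ((hstep hV.isValue).plug hE).red
      have hC : (Ctx.appR (whileTest m e (whileFix m e (compile m e c))) .hole).IsEval :=
        .appR (.lam _) .hole
      have hd := (h l V hV).2 (E.comp (.appR (whileTest m e (whileFix m e (compile m e c))) .hole))
        k (hE.comp hC) (by rwa [Ctx.plug_comp])
      obtain ⟨W, hW, hs⟩ := (h l V hV).1 _ (Part.get_mem hd)
      obtain ⟨X, hX, hs'⟩ := while'_steps he c hW
      have hk := hk.of_steps ((hs.appR (.lam _)).plug hE) |>.of_steps (hs'.plug hE)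
      have hmem := Part.mem_map (fun v : List ℕ =>
        if v.headI = 0 then Sum.inl v.tail else Sum.inr v.tail) (Part.get_mem hd)
      rw [Part.dom_iff_mem]
      split_ifs at hk hmem with h0
      · exact ⟨_, PFun.mem_fix_iff.2 (.inl hmem)⟩
      · obtain ⟨u, hu⟩ := Part.dom_iff_mem.1 (ih _ X hX hk)
        exact ⟨u, PFun.mem_fix_iff.2 (.inr ⟨_, hmem, hu⟩)⟩

theorem implements_compile (he : Function.Injective e) (c : Turing.ToPartrec.Code) :
    Implements m e (compile m e c) c.eval := by
  induction c with
  | zero' =>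
    intro l V hV
    obtain ⟨X, hX, hs⟩ := hV.push false
    rw [Turing.ToPartrec.Code.zero'_eval]
    exact .pure hX hs
  | succ =>
    intro l V hV
    rw [Turing.ToPartrec.Code.succ_eval]
    obtain ⟨L, hL, h₁, hX⟩ := hV.headCons_word he
    obtain ⟨X, hX, h₂⟩ := hX [] _ .nilT
    obtain ⟨Y, hY, h₃⟩ := hX.push true
    refine .pure hY (.trans (.beta hV.isValue rfl) ?_)
    simp only [subst, push_subst, headCons_subst, single_zero, nilT_subst]
    exact (((h₁.appL _).trans h₂).appR (.lam _)).trans h₃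
  | tail =>
    intro l V hV
    obtain ⟨X, hX, hs⟩ := hV.dropHead_word he
    rw [Turing.ToPartrec.Code.tail_eval]
    exact .pure hX hs
  | cons f fs hf hfs =>
    intro l V hV
    rw [Turing.ToPartrec.Code.cons_eval]
    refine .of_steps ?_ (.beta hV.isValue rfl)
    simp only [subst, headCons_subst, single_zero, compile_subst]
    refine (hf l V hV).bind (.appL (.appR (headCons m e) .hole) _)
      (.appL (.appR (.lam _) .hole)) fun u W hW => ?_
    obtain ⟨L, hL, h₁, hX⟩ := hW.headCons_word he
    refine .of_steps ?_ (h₁.appL _)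
    refine (hfs l V hV).bind (.appR L .hole) (.appR hL .hole) fun u' W' hW' => ?_
    obtain ⟨X, hX, h₂⟩ := hX u' W' hW'
    exact .pure hX h₂
  | comp f g hf hg =>
    intro l V hV
    rw [Turing.ToPartrec.Code.comp_eval]
    refine .of_steps ?_ (.beta hV.isValue rfl)
    simp only [subst, single_zero, compile_subst]
    exact (hg l V hV).bind (.appR (compile m e f) .hole) (.appR (compile_isValue f) .hole) hf
  | case f g hf hg =>
    intro l V hV
    rw [Turing.ToPartrec.Code.case_eval]
    refine .of_steps ?_ (.beta hV.isValue rfl)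
    simp only [subst, hd_subst, tl_subst, dropHead_subst, single_zero, compile_subst]
    have h₁ := hV.hd_word he
    obtain _ | ⟨_ | k, l⟩ := l
    -- The lists `[]` and `0 :: l` take the same branch, by the default head `0`.
    iterate 2
      obtain ⟨X, hX, h₂⟩ := hV.dropHead_word he
      exact (hf _ X hX).of_steps ((Steps.iteFalse h₁).trans (h₂.appR (compile_isValue f)))
    -- Removing one letter of the unary head `k + 1` is the predecessor.
    obtain ⟨X, hX, h₂⟩ := hV.tl
    exact (hg (k :: l) X hX).of_steps ((Steps.iteTrue h₁).trans (h₂.appR (compile_isValue g)))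
  | fix f hf => exact implements_while' he f hf

/-! ### Undecidability -/

variable (e) in
/-- The value that represents the list `[k]`. -/
def numeral : ℕ → Term n
  | 0 => .lam (.op (e false) .unit nilT)
  | k + 1 => .lam (.op (e true) .unit (numeral k))

theorem numeral_isValue (k : ℕ) : IsValue (numeral e k) := by
  cases k <;> exact .lam _

/-- The continuation of an effect must syntactically be a value or a variable, which nesting values
directly respects. -/
theorem numeral_hasType (hA : ∀ b, A (e b) = (.unit, .unit)) (Γ : List Ty) (k : ℕ) :
    HasType m A Γ (numeral e k) wordTy := by
  induction k generalizing Γ with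
  | zero => exact .lam (.op_unit (hA _) (.val (.lam _)) (nilT_hasType _ _))
  | succ k ih => exact .lam (.op_unit (hA _) (.val (numeral_isValue k)) (ih _))

theorem numeral_represents (k : ℕ) : Represents m e (word [k]) (numeral e k) := by
  refine ⟨numeral_isValue k, ?_⟩
  induction k with
  | zero =>
    exact .cons (V := nilT) (.beta .unit rfl) (.lam _) Represents.nilT.emits
  | succ k ih =>
    refine .cons (V := numeral e k) (.beta .unit ?_) (numeral_isValue k) ih
    simp [subst, (numeral_hasType (m := .deep) (A := unitSig n) (fun _ => rfl) [] k).closed_subst]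

variable (e) in
theorem primrec_code_numeral : Primrec fun k => (numeral e k).code := by
  -- The tags `5` and `9` are those of `lam` and `op`, and `Nat.pair 2 0` is the code of `unit`.
  have h : Primrec₂ fun (_ c : ℕ) => Nat.pair 5 (Nat.pair 9 (Nat.pair (e true)
      (Nat.pair (Nat.pair 2 0) c))) := by
    refine Primrec₂.natPair.comp (.const _) (Primrec₂.natPair.comp (.const _)
      (Primrec₂.natPair.comp (.const _) (Primrec₂.natPair.comp (.const _) .snd)))
  refine (Primrec.nat_rec₁ (numeral e 0).code h).of_eq fun k => ?_
  induction k with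
  | zero => rfl
  | succ k ih => simp only [ih]; rfl

/-- Under call-by-value, `λ x. fail` exposes `fail` only after its argument has become a value. If
the program diverges, `Computes` applied in the context of this call rules `fail` out. -/
theorem reaches_iff_dom (he : Function.Injective e) (c : Turing.ToPartrec.Code) (k : ℕ) :
    Reaches m (.app (.lam .fail) (.app (compile m e c) (numeral e k))) ↔ (c.eval [k]).Dom := by
  have hc := implements_compile (m := m) he c [k] _ (numeral_represents k)
  refine ⟨fun h => ?_, fun h => ?_⟩
  · obtain ⟨j, hj⟩ := h.exists_reachesIn
    exact hc.2 (.appR (.lam .fail) .hole) j (.appR (.lam _) .hole) hj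
  · obtain ⟨V, hV, hs⟩ := hc.1 _ (Part.get_mem h)
    exact ((hs.appR (.lam _)).trans (.beta hV.isValue rfl)).reds

end Compile

/-- A universal function reads the program from its input. One fixed code therefore suffices, and
only the numeral varies in the reduction, so `compile` need not be shown computable. -/
theorem exists_code_not_computablePred :
    ∃ c : Turing.ToPartrec.Code, ¬ ComputablePred fun k : ℕ => (c.eval [k]).Dom := by
  have hf : Partrec fun k : ℕ => (Denumerable.ofNat Nat.Partrec.Code k).eval 0 :=
    Nat.Partrec.Code.eval_part.comp (Computable.ofNat _) (Computable.const 0)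
  obtain ⟨c, hc⟩ := Turing.ToPartrec.Code.exists_code (Nat.Partrec'.part_iff₁.2 hf)
  refine ⟨c, fun ⟨_, h⟩ => ComputablePred.halting_problem 0 ⟨Classical.decPred _, ?_⟩⟩
  refine (h.comp Computable.encode).of_eq fun c' => ?_
  have := hc ⟨[Encodable.encode c'], rfl⟩
  simp only [decide_eq_decide]
  rw [this]
  simp [List.Vector.head]

/-- Reachability is undecidable in both semantics as soon as there are two distinct effects of type
`unit → unit`. -/
theorem not_reachabilityDecidable {n : ℕ} (m : Mode) (A : Sig n) {e : Bool → Fin n}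
    (he : Function.Injective e) (hA : ∀ b, A (e b) = (.unit, .unit)) :
    ¬ ReachabilityDecidable m A := by
  rintro ⟨f, hf, h⟩
  obtain ⟨c, hc⟩ := exists_code_not_computablePred
  refine hc ⟨Classical.decPred _, ?_⟩
  have hcode : Computable fun k =>
      (Term.app (.lam .fail) (.app (compile m e c) (numeral e k))).code := by
    refine Primrec.to_comp (Primrec₂.natPair.comp (.const _) (Primrec₂.natPair.comp (.const _)
      (Primrec₂.natPair.comp (.const _) (Primrec₂.natPair.comp (.const _)
        (primrec_code_numeral e)))))
  -- Every instance is closed and well typed, so the partial algorithm answers on all of them and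
  -- yields a total decision.
  refine (hf.comp hcode).of_eq_tot fun k => ?_
  obtain ⟨r, hr, hrk⟩ := h (.app (.lam .fail) (.app (compile m e c) (numeral e k)))
    ⟨.unit, .app (σ := wordTy) (.lam .fail) (.app (compile_hasType hA c) (numeral_hasType hA _ k))⟩
  rw [reaches_iff_dom he] at hrk
  convert hr
  rw [← Bool.coe_iff_coe, hrk]
  simp

end BPCFAE

theorem mainTheorem6 :
    (∀ (n : ℕ) (A : BPCFAE.Sig n),
      (∃ αZ αS : Fin n, [αZ, αS].Nodup ∧
        ∀ α ∈ [αZ, αS], A α = (BPCFAE.BaseTy.unit, BPCFAE.BaseTy.unit)) →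
      ¬ BPCFAE.ReachabilityDecidable BPCFAE.Mode.shallow A) ∧
    (∀ (n : ℕ) (A : BPCFAE.Sig n),
      (∃ αZ αS αZ' αS' : Fin n, [αZ, αS, αZ', αS'].Nodup ∧
        ∀ α ∈ [αZ, αS, αZ', αS'], A α = (BPCFAE.BaseTy.unit, BPCFAE.BaseTy.unit)) →
      ¬ BPCFAE.ReachabilityDecidable BPCFAE.Mode.deep A) := by
  have key {n : ℕ} (m : BPCFAE.Mode) (A : BPCFAE.Sig n) {α β : Fin n} (hne : α ≠ β)
      (hα : A α = (.unit, .unit)) (hβ : A β = (.unit, .unit)) :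
      ¬ BPCFAE.ReachabilityDecidable m A := by
    refine BPCFAE.not_reachabilityDecidable m A (e := fun b => cond b β α) ?_ ?_
    · rintro (_ | _) (_ | _) h <;> simp_all [eq_comm]
    · rintro (_ | _) <;> assumption
  refine ⟨fun n A ⟨α, β, hne, h⟩ => ?_, fun n A ⟨α, β, _, _, hne, h⟩ => ?_⟩ <;>
    exact key _ A (by rintro rfl; simp at hne) (h α (by simp)) (h β (by simp))
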